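/- **Model.** A seller has $k$ identical items and faces $n$ unit-demand buyers with values $v_1,\dots,v_n$ drawn i.i.d. from a distribution $F$ on $\mathbb R_+$. Under *competition* each buyer is a separate bidder; under *monopsony* a single intermediary, who knows all the values, represents all $n$ buyers. A bidder who represents a set $S$ of buyers, receives $x$ items and pays $p$ has utility $$\max\Big\{\sum_{i\in S}v_iz_i : z\in[0,1]^S,\ \sum_{i\in S}z_i\le x\Big\}-p ,$$ and bidders maximize expected utility. A (direct) mechanism maps each profile of reported values in the support of $F$ to a lottery over allocations of at most $k$ items to the bidders and to a nonnegative payment of every bidder; for the given demand structure it is *BIC* if truthful reporting is Bayesian incentive compatible and interim individually rational. Let $\mathrm{Rev}^M$ be the supremum of the expected revenue $\mathbb E[\sum_l p_l(\boldsymbol v)]$ over all BIC mechanisms for monopsony. An *optimal mechanism for competition* is a BIC mechanism for competition whose expected revenue is the largest among these. A mechanism $(\boldsymbol x^C,\boldsymbol p^C)$ designed for the $n$ bidders under competition is run under monopsony by letting the monopsonist submit all $n$ reports (or stay out, receiving and paying nothing); she receives all the items allocated to, and makes all the payments charged to, the $n$ bidders. A *Bayes–Nash equilibrium under monopsony* is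 a (possibly mixed) strategy, depending on $\boldsymbol v$, that almost surely plays a utility-maximizing action; $\mathrm{Rev}^M(\boldsymbol x^C,\boldsymbol p^C)$ denotes the seller's expected revenue in such an equilibrium. **Proposition.** For every $\gamma>0$ there exist $n$, $k$ and $F$, and one may take $k=1$ and $F$ the standard exponential distribution, such that 1. there is an optimal mechanism for competition that has a Bayes–Nash equilibrium under monopsony; and 2. for every optimal mechanism $(\boldsymbol x^C,\boldsymbol p^C)$ for competition and every Bayes–Nash equilibrium of it under monopsony, $$\mathrm{Rev}^M(\boldsymbol x^C,\boldsymbol p^C)<\gamma\,\mathrm{Rev}^M .$$ -/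

import Mathlib

open MeasureTheory ProbabilityTheory

noncomputable section

/-- A direct mechanism for selling at most `k` identical items to `m` bidders when there are `n`
buyers.  A profile of reports is a vector `b : Fin n → ℝ`, one reported value per buyer.
* `alloc b a` is the probability that, at the reports `b`, bidder `l` receives `a l` items for
  every `l` (a lottery over feasible joint allocations);
* `pay b l ≥ 0` is the payment of bidder `l` at the reports `b`. -/
structure Mechanism (n m k : ℕ) where
  alloc : (Fin n → ℝ) → (Fin m → Fin (k + 1)) → ℝ
  pay : (Fin n → ℝ) → Fin m → ℝ
  alloc_nonneg : ∀ b a, 0 ≤ alloc b a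
  alloc_sum : ∀ b, ∑ a, alloc b a = 1
  feasible : ∀ b a, alloc b a ≠ 0 → ∑ l, (a l : ℕ) ≤ k
  pay_nonneg : ∀ b l, 0 ≤ pay b l
  measurable_alloc : ∀ a, Measurable fun b => alloc b a
  measurable_pay : ∀ l, Measurable fun b => pay b l

/-- The type space: value profiles all of whose entries lie in the support of `F`. -/
def typeSpace (F : Measure ℝ) (n : ℕ) : Set (Fin n → ℝ) := {v | ∀ i, v i ∈ F.support}

/-- The law of `n` independent values with common distribution `F`. -/
def valueLaw (F : Measure ℝ) (n : ℕ) : Measure (Fin n → ℝ) := Measure.pi fun _ => F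

/-- A demand structure is given by a map `π : Fin n → Fin m`: buyer `i` is represented by
intermediary `π i`.  `surplus π l x v` is the largest total value that intermediary `l` can
generate among the buyers it represents with `x` items, each buyer consuming at most one item.
(The supremum is over a nonempty compact set, so it is a maximum.) -/
def surplus {n m : ℕ} (π : Fin n → Fin m) (l : Fin m) (x : ℕ) (v : Fin n → ℝ) : ℝ :=
  sSup ((fun z : Fin n → ℝ => ∑ i with π i = l, v i * z i) ''
    {z | (∀ i, z i ∈ Set.Icc (0 : ℝ) 1) ∧ ∑ i with π i = l, z i ≤ (x : ℝ)})

/-- The report profile in which intermediary `l` reports `b` for the buyers it represents, and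
all other buyers are reported as `w`. -/
def mergeReports {n m : ℕ} (π : Fin n → Fin m) (l : Fin m) (b w : Fin n → ℝ) : Fin n → ℝ :=
  fun i => if π i = l then b i else w i

/-- The interim expected utility of intermediary `l`, whose buyers have values `v`, when it
reports `b` for them and everybody else reports truthfully.  Since values are independent, the
conditional expectation given the values of `l`'s buyers is the integral over the others'. -/
def interimUtility (F : Measure ℝ) {n m k : ℕ} (π : Fin n → Fin m) (M : Mechanism n m k)
    (l : Fin m) (v b : Fin n → ℝ) : ℝ :=
  ∫ w, ((∑ a, M.alloc (mergeReports π l b w) a * surplus π l (a l) v)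
    - M.pay (mergeReports π l b w) l) ∂(valueLaw F n)

/-- Bayesian incentive compatible and interim individually rational mechanisms for the demand
structure `π`.  The first clause says that interim expected payments are finite: an infinite
expected payment would mean utility `-∞`, contradicting individual rationality. -/
structure IsBIC (F : Measure ℝ) {n m k : ℕ} (π : Fin n → Fin m) (M : Mechanism n m k) :
    Prop where
  integrable_pay : ∀ l, ∀ b ∈ typeSpace F n,
    Integrable (fun w => M.pay (mergeReports π l b w) l) (valueLaw F n)
  ic : ∀ l, ∀ v ∈ typeSpace F n, ∀ b ∈ typeSpace F n,
    interimUtility F π M l v b ≤ interimUtility F π M l v v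
  ir : ∀ l, ∀ v ∈ typeSpace F n, 0 ≤ interimUtility F π M l v v

/-- The expected revenue of a mechanism when all reports are truthful. -/
def revenue (F : Measure ℝ) {n m k : ℕ} (M : Mechanism n m k) : ENNReal :=
  ∫⁻ v, ENNReal.ofReal (∑ l, M.pay v l) ∂(valueLaw F n)

/-- The optimal expected revenue with `k` items under the demand structure `π`. -/
def optRevenue (F : Measure ℝ) {n m : ℕ} (k : ℕ) (π : Fin n → Fin m) : ENNReal :=
  ⨆ (M : Mechanism n m k) (_ : IsBIC F π M), revenue F M

/-- A revenue-maximizing mechanism for the demand structure `π`. -/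
def IsOptimalMechanism (F : Measure ℝ) {n m k : ℕ} (π : Fin n → Fin m)
    (M : Mechanism n m k) : Prop :=
  IsBIC F π M ∧ revenue F M = optRevenue F k π

/-- Competition: every buyer bids for herself. -/
def competition (n : ℕ) : Fin n → Fin n := id

/-- Monopsony: a single intermediary represents all buyers. -/
def monopsony (n : ℕ) : Fin n → Fin 1 := fun _ => 0

/-- What a monopsonist may do in a mechanism designed for `n` separate bidders: submit a report
for each of the `n` buyers, or stay out. -/
abbrev MonopsonyAction (n : ℕ) : Type := (Fin n → ℝ) ⊕ Unit

/-- The total payment made by the monopsonist. -/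
def monopsonyPayment {n k : ℕ} (M : Mechanism n n k) : MonopsonyAction n → ℝ
  | Sum.inl b => ∑ l, M.pay b l
  | Sum.inr _ => 0

/-- The expected payoff of the monopsonist when the buyers' values are `v`: the surplus generated
by all the items received under the `n` identities, less all the payments. -/
def monopsonyPayoff {n k : ℕ} (M : Mechanism n n k) (v : Fin n → ℝ) : MonopsonyAction n → ℝ
  | Sum.inl b =>
      (∑ a, M.alloc b a * surplus (monopsony n) 0 (∑ l, (a l : ℕ)) v) - ∑ l, M.pay b l
  | Sum.inr _ => 0

/-- The admissible actions: reported values must lie in the support of `F`. -/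
def monopsonyActions (F : Measure ℝ) (n : ℕ) : Set (MonopsonyAction n) :=
  {c | ∀ b, c = Sum.inl b → b ∈ typeSpace F n}

/-- `c` is a best response of the monopsonist whose buyers have values `v`. -/
def IsBestResponse (F : Measure ℝ) {n k : ℕ} (M : Mechanism n n k) (v : Fin n → ℝ)
    (c : MonopsonyAction n) : Prop :=
  c ∈ monopsonyActions F n ∧
    ∀ c' ∈ monopsonyActions F n, monopsonyPayoff M v c' ≤ monopsonyPayoff M v c

/-- A (possibly mixed) Bayes-Nash equilibrium of the mechanism `M` under monopsony: there is one
player, who knows all `n` values, and almost surely plays a best response. -/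
def IsMonopsonyEquilibrium (F : Measure ℝ) {n k : ℕ} (M : Mechanism n n k)
    (σ : Kernel (Fin n → ℝ) (MonopsonyAction n)) : Prop :=
  IsMarkovKernel σ ∧ ∀ᵐ v ∂(valueLaw F n), ∀ᵐ c ∂(σ v), IsBestResponse F M v c

/-- The expected revenue of the mechanism `M`, designed for `n` separate bidders, when it faces a
monopsonist who plays the strategy `σ`. -/
def monopsonyRevenue (F : Measure ℝ) {n k : ℕ} (M : Mechanism n n k)
    (σ : Kernel (Fin n → ℝ) (MonopsonyAction n)) : ENNReal :=
  ∫⁻ v, ∫⁻ c, ENNReal.ofReal (monopsonyPayment M c) ∂(σ v) ∂(valueLaw F n)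

end

/-! ### The standard exponential distribution -/

/-! With one item, a monopsonist only cares about the highest value, the total probability of
service and the total payment. If some report profile obtains the item surely for at most `2`, every
best response costs at most `2`: its service probability is at most `1`, so paying more would be
worse than that profile. The seller thus earns at most `2` for every `n`
(`IsOptimalMechanism.monopsonyRevenue_le`). A posted price `p` offered to the monopsonist, in
contrast, earns nearly `p` once `n` is large, so the optimal monopsony revenue is unbounded in `n`
(`le_optRevenue_monopsony`).

It remains to find a cheap profile in every optimal mechanism for competition
(`IsOptimalMechanism.exists_cheap_report`). The virtual value of the exponential law is `t - 1`.
Myerson's bound (`IsBIC.integral_sum_pay_le`) and the second-price auction with reserve `1`, which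
attains it, show that the optimal revenue is the mean of `max (topValue v - 1) 0`. Hence an optimal
mechanism almost surely sells to a highest bidder when the top value exceeds `1`, and sells nothing
when it is below `1`. Interim individual rationality makes bidders with values at most `2` pay on
average at most `2` per item. If every profile with a sure sale cost more than `2`, these bidders
would pay more than that, because all values lie in `(1, 2)` with positive probability.

The same second-price auction has an explicit equilibrium under monopsony, which gives the existence
claim. -/

instance isProbabilityMeasure_expMeasure_one : IsProbabilityMeasure (expMeasure 1) :=
  isProbabilityMeasure_expMeasure one_pos

lemma expMeasure_one_eq : expMeasure 1 = volume.withDensity (exponentialPDF 1) := rfl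

lemma measurable_exponentialPDF_one : Measurable (exponentialPDF 1) :=
  (measurable_exponentialPDFReal 1).ennreal_ofReal

lemma toReal_exponentialPDF_one_smul (f : ℝ → ℝ) :
    (fun t => (exponentialPDF 1 t).toReal • f t) =
      (Set.Ici 0).indicator fun t => Real.exp (-t) * f t := by
  ext t
  by_cases ht : 0 ≤ t
  · rw [exponentialPDF_of_nonneg ht, ENNReal.toReal_ofReal (by positivity)]
    simp [ht]
  · rw [exponentialPDF_of_neg (not_le.1 ht)]
    simp [ht]

lemma integral_expMeasure_one (f : ℝ → ℝ) :
    ∫ t, f t ∂expMeasure 1 = ∫ t in Set.Ioi 0, Real.exp (-t) * f t := by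
  rw [expMeasure_one_eq, integral_withDensity_eq_integral_toReal_smul
    measurable_exponentialPDF_one (by simp [exponentialPDF]), toReal_exponentialPDF_one_smul,
    integral_indicator measurableSet_Ici, integral_Ici_eq_integral_Ioi]

lemma integrable_expMeasure_one_iff (f : ℝ → ℝ) :
    Integrable f (expMeasure 1) ↔ IntegrableOn (fun t => Real.exp (-t) * f t) (Set.Ioi 0) := by
  rw [expMeasure_one_eq, integrable_withDensity_iff_integrable_smul'
    measurable_exponentialPDF_one (by simp [exponentialPDF]), toReal_exponentialPDF_one_smul,
    integrable_indicator_iff measurableSet_Ici, integrableOn_Ici_iff_integrableOn_Ioi]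

lemma integrable_id_expMeasure_one : Integrable (fun t : ℝ => t) (expMeasure 1) := by
  rw [integrable_expMeasure_one_iff]
  have h := Real.GammaIntegral_convergent (s := 2) two_pos
  refine h.congr_fun (fun t _ => ?_) measurableSet_Ioi
  norm_num

lemma ae_nonneg_expMeasure_one : ∀ᵐ t ∂expMeasure 1, 0 ≤ t := by
  rw [ae_iff, expMeasure_one_eq, withDensity_apply _ (by measurability)]
  have : {a : ℝ | ¬ 0 ≤ a} = Set.Iio 0 := by ext; simp
  rw [this, lintegral_exponentialPDF_of_nonpos le_rfl]

instance nullSingletonClass_expMeasure_one : NullSingletonClass (expMeasure 1) := by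
  rw [expMeasure_one_eq]; infer_instance

lemma expMeasure_one_Ioo_pos {a b : ℝ} (ha : 0 ≤ a) (hab : a < b) :
    0 < expMeasure 1 (Set.Ioo a b) := by
  rw [expMeasure_one_eq, withDensity_apply _ measurableSet_Ioo,
    setLIntegral_pos_iff measurable_exponentialPDF_one]
  have : Set.Ioo a b ⊆ Function.support (exponentialPDF 1) := fun t ht => by
    have := exponentialPDFReal_pos one_pos (ha.trans_lt ht.1)
    simpa [exponentialPDF] using this
  rw [Set.inter_eq_self_of_subset_right this]
  simpa using hab

lemma support_expMeasure_one : (expMeasure 1).support = Set.Ici 0 := by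
  apply Set.Subset.antisymm
  · exact Measure.support_subset_of_isClosed isClosed_Ici ae_nonneg_expMeasure_one
  · intro t ht
    rw [Measure.mem_support_iff_forall]
    intro U hU
    obtain ⟨ε, hε, hs⟩ := Metric.mem_nhds_iff.1 hU
    refine (expMeasure_one_Ioo_pos (Set.mem_Ici.1 ht) (lt_add_of_pos_right t hε)).trans_le
      (measure_mono fun s hs' => hs ?_)
    rw [Real.ball_eq_Ioo]
    exact ⟨by linarith [hs'.1], hs'.2⟩

/-- The envelope inequality for the standard exponential distribution: if `X` is a selection of
subgradients of a nonnegative `U` of at most linear growth, then `X` has smaller mean than `U`. -/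
lemma integral_le_integral_of_subgradient {U X : ℝ → ℝ} (hU : Measurable U) (hX : Measurable X)
    (hU0 : ∀ t, 0 ≤ t → 0 ≤ U t) (hUt : ∀ t, 0 ≤ t → U t ≤ t) (hX0 : ∀ t, 0 ≤ X t)
    (hX1 : ∀ t, X t ≤ 1)
    (hIC : ∀ s t, 0 ≤ s → 0 ≤ t → U t + (s - t) * X t ≤ U s) :
    ∫ t, X t ∂expMeasure 1 ≤ ∫ t, U t ∂expMeasure 1 := by
  have iX : Integrable X (expMeasure 1) :=
    Integrable.of_bound hX.aestronglyMeasurable 1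
      (ae_of_all _ fun t => by rw [Real.norm_of_nonneg (hX0 t)]; exact hX1 t)
  have iU : Integrable U (expMeasure 1) := by
    refine integrable_id_expMeasure_one.mono hU.aestronglyMeasurable ?_
    filter_upwards [ae_nonneg_expMeasure_one] with t ht
    rw [Real.norm_of_nonneg (hU0 t ht), Real.norm_of_nonneg ht]
    exact hUt t ht
  have hJ1 : ∫ t, X t ∂expMeasure 1 ≤ 1 := by
    simpa using integral_mono iX (integrable_const (1 : ℝ)) hX1
  set J := ∫ t, X t ∂expMeasure 1
  set I := ∫ t, U t ∂expMeasure 1 with hI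
  have iU' := (integrable_expMeasure_one_iff U).1 iU
  -- Integrate `U t + h * X t ≤ U (t + h)`. By memorylessness, shifting by `h` multiplies the
  -- density by `exp h` and only drops the nonnegative part of the integral over `(0, h]`. No
  -- differentiability of `U` is needed.
  have key : ∀ h : ℝ, 0 < h → I + h * J ≤ Real.exp h * I := by
    intro h hh
    have e1 : ∀ t, Real.exp (-t) * U (t + h) =
        Real.exp h * (Real.exp (-(t + h)) * U (t + h)) := fun t => by
      rw [← mul_assoc, ← Real.exp_add]; congr 2; ring
    have iS : IntegrableOn (fun t => Real.exp (-(t + h)) * U (t + h)) (Set.Ioi 0) := by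
      have := ((measurePreserving_add_right volume h).integrableOn_comp_preimage
        (measurableEmbedding_addRight h) (f := fun t => Real.exp (-t) * U t)).2
        (iU'.mono_set (Set.Ioi_subset_Ioi hh.le))
      simpa [Set.preimage_add_const_Ioi, Function.comp_def] using this
    have iS' : Integrable (fun t => U (t + h)) (expMeasure 1) := by
      rw [integrable_expMeasure_one_iff]
      simp_rw [e1]
      exact iS.const_mul _
    calc I + h * J = ∫ t, (U t + h * X t) ∂expMeasure 1 := by
          rw [integral_add iU (iX.const_mul h), integral_const_mul]
      _ ≤ ∫ t, U (t + h) ∂expMeasure 1 := by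
          refine integral_mono_ae (iU.add (iX.const_mul h)) iS' ?_
          filter_upwards [ae_nonneg_expMeasure_one] with t ht
          have := hIC (t + h) t (by linarith) ht
          simpa using this
      _ = Real.exp h * ∫ t in Set.Ioi h, Real.exp (-t) * U t := by
          rw [integral_expMeasure_one]
          simp_rw [e1]
          have := (measurePreserving_add_right volume h).setIntegral_preimage_emb
            (measurableEmbedding_addRight h) (fun t => Real.exp (-t) * U t) (Set.Ioi h)
          rw [Set.preimage_add_const_Ioi, sub_self] at this
          rw [integral_const_mul, this]
      _ ≤ Real.exp h * I := by
          rw [hI, integral_expMeasure_one]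
          refine mul_le_mul_of_nonneg_left ?_ (Real.exp_pos h).le
          refine setIntegral_mono_set iU' ?_ (Set.Ioi_subset_Ioi hh.le).eventuallyLE
          filter_upwards [ae_restrict_mem measurableSet_Ioi] with t ht
          exact mul_nonneg (Real.exp_pos _).le (hU0 t (Set.mem_Ioi.1 ht).le)
  have hI0 : 0 ≤ I := by
    refine integral_nonneg_of_ae ?_
    filter_upwards [ae_nonneg_expMeasure_one] with t ht using hU0 t ht
  -- Multiply `key` by `1 - h ≤ exp (-h)`: the terms `I` cancel and a factor `h` can be divided out.
  have key2 : ∀ h : ℝ, 0 < h → h < 1 → (1 - h) * J ≤ I := by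
    intro h h0 h1
    have h2 := key h h0
    have h3 : Real.exp h * (1 - h) ≤ 1 := by
      have := Real.one_sub_le_exp_neg h
      calc Real.exp h * (1 - h) ≤ Real.exp h * Real.exp (-h) := by gcongr
        _ = 1 := by rw [← Real.exp_add]; simp
    have h4 : (1 - h) * (I + h * J) ≤ I := by
      calc (1 - h) * (I + h * J) ≤ (1 - h) * (Real.exp h * I) := by
            gcongr
        _ = (Real.exp h * (1 - h)) * I := by ring
        _ ≤ 1 * I := by gcongr
        _ = I := one_mul _
    have h5 : h * ((1 - h) * J) ≤ h * I := by linarith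
    exact le_of_mul_le_mul_left h5 h0
  -- Let `h` tend to `0`: since `J ≤ 1`, the choice `h = min ε (1 / 2)` loses at most `ε`.
  refine le_of_forall_pos_le_add fun ε hε => ?_
  have h0 : 0 < min ε (1 / 2) := by positivity
  have := key2 (min ε (1 / 2)) h0 (by linarith [min_le_right ε (1 / 2)])
  have h6 : min ε (1 / 2) * J ≤ min ε (1 / 2) * 1 := by gcongr
  linarith [min_le_left ε (1 / 2)]

/-- The virtual value of the standard exponential distribution is `t - 1`. -/
lemma integral_virtual_value_sub_price {m : ℝ} (hm : 0 ≤ m) :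
    ∫ t, (Set.Ioi m).indicator (fun t => t - 1 - m) t ∂expMeasure 1 = 0 := by
  -- This antiderivative of the weighted integrand vanishes both at `m` and at infinity.
  have hd : ∀ t ∈ Set.Ici m, HasDerivAt (fun t => -((t - m) * Real.exp (-t)))
      (Real.exp (-t) * (t - 1 - m)) t := by
    intro t _
    have h1 : HasDerivAt (fun t => Real.exp (-t)) (Real.exp (-t) * (-1)) t :=
      (hasDerivAt_neg t).exp
    have h2 := (((hasDerivAt_id t).sub_const m).mul h1).neg
    convert! h2 using 1
    simp; ring
  have hlim : Filter.Tendsto (fun t : ℝ => -((t - m) * Real.exp (-t))) Filter.atTop (nhds 0) := by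
    have h1 := Real.tendsto_pow_mul_exp_neg_atTop_nhds_zero 1
    have h2 := Real.tendsto_pow_mul_exp_neg_atTop_nhds_zero 0
    have := (h1.sub (h2.const_mul m)).neg
    simp only [pow_one, pow_zero, one_mul, mul_zero, sub_zero, neg_zero] at this
    refine this.congr fun t => by ring
  have hint : IntegrableOn (fun t => Real.exp (-t) * (t - 1 - m)) (Set.Ioi m) :=
    ((integrable_expMeasure_one_iff _).1 ((integrable_id_expMeasure_one.sub
      (integrable_const 1)).sub (integrable_const m))).mono_set (Set.Ioi_subset_Ioi hm)
  have := integral_Ioi_of_hasDerivAt_of_tendsto' hd hint hlim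
  rw [integral_expMeasure_one]
  have e : ∀ t, Real.exp (-t) * (Set.Ioi m).indicator (fun t => t - 1 - m) t =
      (Set.Ioi m).indicator (fun t => Real.exp (-t) * (t - 1 - m)) t := fun t => by
    by_cases h : t ∈ Set.Ioi m <;> simp [h]
  simp_rw [e]
  rw [setIntegral_indicator measurableSet_Ioi,
    Set.inter_eq_self_of_subset_right (Set.Ioi_subset_Ioi hm), this]
  simp

/-! ### Demand structures and truthful reports -/

/-- The highest entry of a profile. -/
noncomputable def topValue {n : ℕ} (b : Fin n → ℝ) : ℝ := ⨆ i, b i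

section TopValue

variable {n : ℕ}

lemma le_topValue (b : Fin n → ℝ) (i : Fin n) : b i ≤ topValue b :=
  le_ciSup (Set.finite_range b).bddAbove i

lemma exists_eq_topValue [NeZero n] (b : Fin n → ℝ) : ∃ i, b i = topValue b :=
  exists_eq_ciSup_of_finite

lemma measurable_topValue : Measurable (topValue : (Fin n → ℝ) → ℝ) :=
  Measurable.iSup fun i => measurable_pi_apply i

lemma topValue_nonneg [NeZero n] {b : Fin n → ℝ} (hb : ∀ i, 0 ≤ b i) : 0 ≤ topValue b :=
  (hb 0).trans (le_topValue b 0)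

end TopValue

/-- With at most one item, the best use of it is to serve a buyer with the highest value. -/
lemma surplus_eq {n m : ℕ} (π : Fin n → Fin m) (l : Fin m) {x : ℕ} (hx : x ≤ 1) {v : Fin n → ℝ}
    {i : Fin n} (hi : π i = l) (hv : 0 ≤ v i) (hmax : ∀ j, π j = l → v j ≤ v i) :
    surplus π l x v = x * v i := by
  -- The maximizer gives everything to buyer `i`; it respects unit demand because `x ≤ 1`.
  refine IsGreatest.csSup_eq ⟨⟨Pi.single i (x : ℝ), ⟨fun j => ?_, ?_⟩, ?_⟩, ?_⟩
  · have : (x : ℝ) ≤ 1 := by exact_mod_cast hx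
    by_cases h : j = i
    · subst h; simpa using this
    · simp [h]
  · rw [Finset.sum_pi_single']
    split_ifs <;> simp
  · have : ∀ j, v j * (Pi.single i (x : ℝ) : Fin n → ℝ) j =
        (Pi.single i (v i * x) : Fin n → ℝ) j := fun j => by
      by_cases h : j = i
      · subst h; simp
      · simp [h]
    simp only [this]
    rw [Finset.sum_pi_single', if_pos (by simpa using hi), mul_comm]
  · rintro _ ⟨z, ⟨hz, hs⟩, rfl⟩
    calc ∑ j with π j = l, v j * z j ≤ ∑ j with π j = l, v i * z j :=
          Finset.sum_le_sum fun j hj =>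
            mul_le_mul_of_nonneg_right (hmax j (by simpa using hj)) (hz j).1
      _ = v i * ∑ j with π j = l, z j := by rw [Finset.mul_sum]
      _ ≤ v i * x := by gcongr
      _ = x * v i := mul_comm _ _

lemma surplus_competition {n : ℕ} (l : Fin n) {x : ℕ} (hx : x ≤ 1) {v : Fin n → ℝ}
    (hv : 0 ≤ v l) : surplus (competition n) l x v = x * v l :=
  surplus_eq _ _ hx rfl hv fun j hj => by rw [show j = l from hj]

lemma surplus_monopsony {n : ℕ} [NeZero n] {x : ℕ} (hx : x ≤ 1) {v : Fin n → ℝ}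
    (hv : ∀ i, 0 ≤ v i) : surplus (monopsony n) 0 x v = x * topValue v := by
  obtain ⟨i, hi⟩ := exists_eq_topValue v
  rw [← hi]
  exact surplus_eq _ _ hx rfl (hv i) fun j _ => hi ▸ le_topValue v j

lemma mergeReports_competition {n : ℕ} (l : Fin n) (b w : Fin n → ℝ) :
    mergeReports (competition n) l b w = Function.update w l (b l) := by
  ext i
  by_cases h : i = l
  · subst h; simp [mergeReports, competition]
  · simp [mergeReports, competition, h]

lemma mergeReports_monopsony {n : ℕ} (b w : Fin n → ℝ) :
    mergeReports (monopsony n) 0 b w = b := by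
  ext i
  simp [mergeReports, monopsony]

lemma mem_typeSpace_expMeasure_one {n : ℕ} {v : Fin n → ℝ} :
    v ∈ typeSpace (expMeasure 1) n ↔ ∀ i, 0 ≤ v i := by
  simp [typeSpace, support_expMeasure_one]

/-! ### Independent values -/

section ValueLaw

variable {F : Measure ℝ} [IsProbabilityMeasure F] {n : ℕ}

instance isProbabilityMeasure_valueLaw : IsProbabilityMeasure (valueLaw F n) := by
  unfold valueLaw; infer_instance

lemma ae_valueLaw_of_forall {p : Fin n → ℝ → Prop} (h : ∀ i, ∀ᵐ t ∂F, p i t) :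
    ∀ᵐ v ∂valueLaw F n, ∀ i, p i (v i) := by
  rw [ae_all_iff]
  intro i
  exact (Measure.quasiMeasurePreserving_eval (fun _ : Fin n => F) i).ae (h i)

lemma measurable_update_pair (l : Fin n) :
    Measurable fun p : ℝ × (Fin n → ℝ) => Function.update p.2 l p.1 := by
  refine measurable_pi_lambda _ fun i => ?_
  by_cases h : i = l
  · subst h; simpa using measurable_fst
  · simpa [h, Function.comp_def] using (measurable_pi_apply i).comp measurable_snd

/-- Resampling one coordinate independently does not change the law of the values. -/
lemma measurePreserving_update (l : Fin n) :
    MeasurePreserving (fun p : ℝ × (Fin n → ℝ) => Function.update p.2 l p.1)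
      (F.prod (valueLaw F n)) (valueLaw F n) := by
  refine ⟨measurable_update_pair l, ?_⟩
  refine (Measure.pi_eq fun s hs => ?_).symm
  have hpre : (fun p : ℝ × (Fin n → ℝ) => Function.update p.2 l p.1) ⁻¹' Set.univ.pi s =
      s l ×ˢ Set.univ.pi (Function.update s l Set.univ) := by
    ext ⟨t, w⟩
    simp only [Set.mem_preimage, Set.mem_univ_pi, Set.mem_prod]
    constructor
    · intro h
      refine ⟨by simpa using h l, fun i => ?_⟩
      by_cases hi : i = l
      · subst hi; simp
      · simpa [hi] using h i
    · rintro ⟨h1, h2⟩ i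
      by_cases hi : i = l
      · subst hi; simpa using h1
      · simpa [hi] using h2 i
  rw [Measure.map_apply (measurable_update_pair l) (MeasurableSet.univ_pi hs), hpre,
    Measure.prod_prod, valueLaw, Measure.pi_pi, ← Finset.mul_prod_erase _ _ (Finset.mem_univ l),
    ← Finset.mul_prod_erase Finset.univ (fun i => F (s i)) (Finset.mem_univ l)]
  simp only [Function.update_self, measure_univ, one_mul]
  congr 1
  refine Finset.prod_congr rfl fun i hi => ?_
  rw [Function.update_of_ne (Finset.ne_of_mem_erase hi)]

/-- Passage from ex ante to interim expectations. Coordinate `l` of `w` is overwritten, so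
integrating over all of `w` amounts to integrating over the other bidders' values. -/
lemma integral_valueLaw_eq (l : Fin n) {f : (Fin n → ℝ) → ℝ} (hf : Integrable f (valueLaw F n)) :
    ∫ v, f v ∂valueLaw F n = ∫ t, ∫ w, f (Function.update w l t) ∂valueLaw F n ∂F := by
  have h := measurePreserving_update (F := F) l
  rw [← h.map_eq, integral_map h.measurable.aemeasurable (by
    rw [h.map_eq]; exact hf.aestronglyMeasurable), h.map_eq]
  exact integral_prod _ (h.integrable_comp_of_integrable hf)

lemma integral_valueLaw_eq_swap (l : Fin n) {f : (Fin n → ℝ) → ℝ}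
    (hf : Integrable f (valueLaw F n)) :
    ∫ v, f v ∂valueLaw F n = ∫ w, ∫ t, f (Function.update w l t) ∂F ∂valueLaw F n := by
  rw [integral_valueLaw_eq l hf]
  exact integral_integral_swap
    ((measurePreserving_update (F := F) l).integrable_comp_of_integrable hf)

/-- Tonelli for a nonnegative integrand. It is meant for payments, which have no pointwise bound but
whose interim means individual rationality controls. -/
lemma integrable_valueLaw_of_interim (l : Fin n) {f : (Fin n → ℝ) → ℝ} (hf : Measurable f)
    (hf0 : ∀ v, 0 ≤ f v)
    (h1 : ∀ᵐ t ∂F, Integrable (fun w => f (Function.update w l t)) (valueLaw F n))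
    (h2 : Integrable (fun t => ∫ w, f (Function.update w l t) ∂valueLaw F n) F) :
    Integrable f (valueLaw F n) := by
  have h := measurePreserving_update (F := F) l
  rw [← h.map_eq, integrable_map_measure hf.aestronglyMeasurable h.measurable.aemeasurable,
    integrable_prod_iff (hf.comp h.measurable).aestronglyMeasurable]
  refine ⟨h1, ?_⟩
  simpa [Real.norm_of_nonneg (hf0 _)] using h2

lemma measurable_interim (l : Fin n) {f : (Fin n → ℝ) → ℝ} (hf : Measurable f) :
    Measurable fun t => ∫ w, f (Function.update w l t) ∂valueLaw F n :=
  ((hf.comp (measurable_update_pair l)).stronglyMeasurable.integral_prod_right').measurable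

lemma integrable_eval_comp (l : Fin n) {g : ℝ → ℝ} (hg : Integrable g F) :
    Integrable (fun v : Fin n → ℝ => g (v l)) (valueLaw F n) :=
  (measurePreserving_eval (fun _ : Fin n => F) l).integrable_comp_of_integrable hg

end ValueLaw

/-! ### Mechanisms for separate bidders -/

section Items

variable {n : ℕ} (M : Mechanism n n 1)

/-- The expected number of items that bidder `l` receives. -/
noncomputable def expItems (b : Fin n → ℝ) (l : Fin n) : ℝ := ∑ a, M.alloc b a * ((a l : ℕ) : ℝ)

lemma expItems_nonneg (b : Fin n → ℝ) (l : Fin n) : 0 ≤ expItems M b l :=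
  Finset.sum_nonneg fun a _ => mul_nonneg (M.alloc_nonneg b a) (Nat.cast_nonneg _)

lemma sum_expItems (b : Fin n → ℝ) :
    ∑ l, expItems M b l = ∑ a, M.alloc b a * ((∑ l, (a l : ℕ) : ℕ) : ℝ) := by
  unfold expItems
  rw [Finset.sum_comm]
  simp [Finset.mul_sum]

lemma sum_expItems_le_one (b : Fin n → ℝ) : ∑ l, expItems M b l ≤ 1 := by
  rw [sum_expItems, ← M.alloc_sum b]
  refine Finset.sum_le_sum fun a _ => ?_
  by_cases h : M.alloc b a = 0
  · simp [h]
  · have h1 : ((∑ l, (a l : ℕ) : ℕ) : ℝ) ≤ 1 := by exact_mod_cast M.feasible b a h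
    exact mul_le_of_le_one_right (M.alloc_nonneg b a) h1

lemma expItems_le_one (b : Fin n → ℝ) (l : Fin n) : expItems M b l ≤ 1 :=
  (Finset.single_le_sum (fun i _ => expItems_nonneg M b i) (Finset.mem_univ l)).trans
    (sum_expItems_le_one M b)

lemma measurable_expItems (l : Fin n) : Measurable fun b => expItems M b l :=
  Finset.measurable_sum _ fun a _ => (M.measurable_alloc a).mul_const _

lemma monopsonyPayoff_inl [NeZero n] {v : Fin n → ℝ} (hv : ∀ i, 0 ≤ v i) (b : Fin n → ℝ) :
    monopsonyPayoff M v (Sum.inl b) =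
      topValue v * ∑ l, expItems M b l - ∑ l, M.pay b l := by
  rw [monopsonyPayoff, sum_expItems, Finset.mul_sum]
  congr 1
  refine Finset.sum_congr rfl fun a _ => ?_
  -- Only allocations of positive probability are known to contain at most one item.
  by_cases h : M.alloc b a = 0
  · simp [h]
  · rw [surplus_monopsony (M.feasible b a h) hv]
    ring

lemma sum_alloc_mul_surplus_competition {v : Fin n → ℝ} (l : Fin n) (hv : 0 ≤ v l)
    (b : Fin n → ℝ) :
    ∑ a, M.alloc b a * surplus (competition n) l (a l) v = v l * expItems M b l := by
  rw [expItems, Finset.mul_sum]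
  refine Finset.sum_congr rfl fun a _ => ?_
  rw [surplus_competition l (Nat.lt_succ_iff.1 (a l).2) hv]
  ring

variable {F : Measure ℝ}

lemma integrable_expItems_comp {α : Type*} [MeasurableSpace α] {μ : Measure α}
    [IsFiniteMeasure μ] (l : Fin n) {f : α → Fin n → ℝ} (hf : Measurable f) :
    Integrable (fun x => expItems M (f x) l) μ :=
  Integrable.of_bound ((measurable_expItems M l).comp hf).aestronglyMeasurable 1
    (ae_of_all _ fun x => by
      rw [Real.norm_of_nonneg (expItems_nonneg M _ l)]; exact expItems_le_one M _ l)

lemma measurable_update_const (l : Fin n) (t : ℝ) :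
    Measurable fun w : Fin n → ℝ => Function.update w l t :=
  (measurable_update_pair l).comp measurable_prodMk_left

lemma interimUtility_competition (l : Fin n) {v b : Fin n → ℝ} (hv : 0 ≤ v l) :
    interimUtility F (competition n) M l v b =
      ∫ w, (v l * expItems M (Function.update w l (b l)) l
        - M.pay (Function.update w l (b l)) l) ∂valueLaw F n := by
  unfold interimUtility
  simp only [sum_alloc_mul_surplus_competition M l hv, mergeReports_competition]

variable (F) in
/-- The probability with which bidder `l` expects to be served when reporting `t`. -/
noncomputable def interimItems (l : Fin n) (t : ℝ) : ℝ :=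
  ∫ w, expItems M (Function.update w l t) l ∂valueLaw F n

variable (F) in
/-- The payment that bidder `l` expects when reporting `t`. -/
noncomputable def interimPay (l : Fin n) (t : ℝ) : ℝ :=
  ∫ w, M.pay (Function.update w l t) l ∂valueLaw F n

lemma interimItems_nonneg (l : Fin n) (t : ℝ) : 0 ≤ interimItems M F l t :=
  integral_nonneg fun _ => expItems_nonneg M _ l

lemma interimPay_nonneg (l : Fin n) (t : ℝ) : 0 ≤ interimPay M F l t :=
  integral_nonneg fun _ => M.pay_nonneg _ l

variable [IsProbabilityMeasure F]

lemma interimItems_le_one (l : Fin n) (t : ℝ) : interimItems M F l t ≤ 1 := by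
  rw [interimItems]
  have := integral_mono (integrable_expItems_comp M (μ := valueLaw F n) l
    (measurable_update_const l t)) (integrable_const (1 : ℝ)) (fun _ => expItems_le_one M _ l)
  simpa using this

lemma measurable_interimItems (l : Fin n) : Measurable (interimItems M F l) :=
  measurable_interim l (measurable_expItems M l)

lemma measurable_interimPay (l : Fin n) : Measurable (interimPay M F l) :=
  measurable_interim l (M.measurable_pay l)

end Items

section BIC

variable {n : ℕ} {M : Mechanism n n 1} (hM : IsBIC (expMeasure 1) (competition n) M)
include hM

lemma IsBIC.integrable_pay_update (l : Fin n) {t : ℝ} (ht : 0 ≤ t) :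
    Integrable (fun w => M.pay (Function.update w l t) l) (valueLaw (expMeasure 1) n) := by
  have := hM.integrable_pay l (fun _ => t) (mem_typeSpace_expMeasure_one.2 fun _ => ht)
  simpa only [mergeReports_competition] using this

/-- Only coordinate `l` of the values and of the reports matters, so constant profiles suffice to
reach every one-dimensional type. -/
lemma IsBIC.interimUtility_eq (l : Fin n) {s t : ℝ} (hs : 0 ≤ s) (ht : 0 ≤ t) :
    interimUtility (expMeasure 1) (competition n) M l (fun _ => s) (fun _ => t) =
      s * interimItems M (expMeasure 1) l t - interimPay M (expMeasure 1) l t := by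
  rw [interimUtility_competition M l hs, integral_sub
    ((integrable_expItems_comp M l (measurable_update_const l t)).const_mul _)
    (hM.integrable_pay_update l ht), integral_const_mul, interimItems, interimPay]

lemma IsBIC.interim_ic (l : Fin n) {s t : ℝ} (hs : 0 ≤ s) (ht : 0 ≤ t) :
    s * interimItems M (expMeasure 1) l t - interimPay M (expMeasure 1) l t ≤
      s * interimItems M (expMeasure 1) l s - interimPay M (expMeasure 1) l s := by
  rw [← hM.interimUtility_eq l hs ht, ← hM.interimUtility_eq l hs hs]
  exact hM.ic l _ (mem_typeSpace_expMeasure_one.2 fun _ => hs) _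
    (mem_typeSpace_expMeasure_one.2 fun _ => ht)

lemma IsBIC.interimPay_le (l : Fin n) {t : ℝ} (ht : 0 ≤ t) :
    interimPay M (expMeasure 1) l t ≤ t * interimItems M (expMeasure 1) l t := by
  have := hM.ir l _ (mem_typeSpace_expMeasure_one.2 fun _ => ht)
  rw [hM.interimUtility_eq l ht ht] at this
  linarith

lemma IsBIC.integrable_interimPay (l : Fin n) :
    Integrable (interimPay M (expMeasure 1) l) (expMeasure 1) := by
  refine integrable_id_expMeasure_one.mono (measurable_interimPay M l).aestronglyMeasurable ?_
  filter_upwards [ae_nonneg_expMeasure_one] with t ht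
  rw [Real.norm_of_nonneg (interimPay_nonneg M l t), Real.norm_of_nonneg ht]
  exact (hM.interimPay_le l ht).trans (mul_le_of_le_one_right ht (interimItems_le_one M l t))

lemma IsBIC.integrable_pay_valueLaw (l : Fin n) :
    Integrable (fun v => M.pay v l) (valueLaw (expMeasure 1) n) := by
  refine integrable_valueLaw_of_interim l (M.measurable_pay l) (fun v => M.pay_nonneg v l) ?_
    (hM.integrable_interimPay l)
  filter_upwards [ae_nonneg_expMeasure_one] with t ht using hM.integrable_pay_update l ht

lemma IsBIC.revenue_eq :
    revenue (expMeasure 1) M =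
      ENNReal.ofReal (∫ v, ∑ l, M.pay v l ∂valueLaw (expMeasure 1) n) := by
  rw [revenue, ofReal_integral_eq_lintegral_ofReal
    (integrable_finsetSum _ fun l _ => hM.integrable_pay_valueLaw l)
    (ae_of_all _ fun v => Finset.sum_nonneg fun l _ => M.pay_nonneg v l)]

omit hM in
lemma integrable_mul_expItems (M : Mechanism n n 1) (l : Fin n) {g : ℝ → ℝ}
    (hg : Integrable g (expMeasure 1)) :
    Integrable (fun v => g (v l) * expItems M v l) (valueLaw (expMeasure 1) n) := by
  have := (integrable_eval_comp (n := n) l hg).mul_bdd (c := 1) (g := fun v => expItems M v l)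
    (measurable_expItems M l).aestronglyMeasurable (ae_of_all _ fun v => by
      rw [Real.norm_of_nonneg (expItems_nonneg M v l)]; exact expItems_le_one M v l)
  exact this

omit hM in
lemma integral_mul_expItems (M : Mechanism n n 1) (l : Fin n) {g : ℝ → ℝ}
    (hg : Integrable g (expMeasure 1)) :
    ∫ v, g (v l) * expItems M v l ∂valueLaw (expMeasure 1) n =
      ∫ t, g t * interimItems M (expMeasure 1) l t ∂expMeasure 1 := by
  rw [integral_valueLaw_eq l (integrable_mul_expItems M l hg)]
  simp only [Function.update_self, integral_const_mul, interimItems]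

/-- A bidder pays on average at most the virtual value times the probability of service. -/
lemma IsBIC.integral_pay_le (l : Fin n) :
    ∫ v, M.pay v l ∂valueLaw (expMeasure 1) n ≤
      ∫ v, (v l - 1) * expItems M v l ∂valueLaw (expMeasure 1) n := by
  have iid := integrable_id_expMeasure_one
  have i1 : Integrable (fun t : ℝ => t - 1) (expMeasure 1) := iid.sub (integrable_const 1)
  rw [integral_mul_expItems M l (g := fun t => t - 1) i1,
    integral_valueLaw_eq l (hM.integrable_pay_valueLaw l)]
  change ∫ t, interimPay M (expMeasure 1) l t ∂expMeasure 1 ≤ _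
  set X := interimItems M (expMeasure 1) l with hX
  set P := interimPay M (expMeasure 1) l with hP
  have mX : Measurable X := measurable_interimItems M l
  have mP : Measurable P := measurable_interimPay M l
  have bX : ∀ᵐ t ∂expMeasure 1, ‖X t‖ ≤ 1 := ae_of_all _ fun t => by
    rw [Real.norm_of_nonneg (interimItems_nonneg M l t)]; exact interimItems_le_one M l t
  have iX : Integrable X (expMeasure 1) := Integrable.of_bound mX.aestronglyMeasurable 1 bX
  have itX : Integrable (fun t => t * X t) (expMeasure 1) :=
    iid.mul_bdd (c := 1) mX.aestronglyMeasurable bX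
  have iP : Integrable P (expMeasure 1) := hM.integrable_interimPay l
  -- The truthful interim utility is `t * X t - P t`. Incentive compatibility makes `X` a selection
  -- of its subgradients, individual rationality makes it nonnegative, and nonnegative payments
  -- bound it by `t`.
  have h := integral_le_integral_of_subgradient (U := fun t => t * X t - P t) (X := X)
    ((measurable_id.mul mX).sub mP) mX
    (fun t ht => sub_nonneg.2 (hM.interimPay_le l ht))
    (fun t ht => by
      have h1 := mul_le_of_le_one_right ht (interimItems_le_one M (F := expMeasure 1) l t)
      have h2 := interimPay_nonneg M (F := expMeasure 1) l t
      simp only [hX, hP]; linarith)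
    (interimItems_nonneg M l) (interimItems_le_one M l)
    (fun s t hs ht => by have := hM.interim_ic l hs ht; simp only [hX, hP]; linarith)
  rw [integral_sub itX iP] at h
  have : ∫ t, (t - 1) * X t ∂expMeasure 1 =
      ∫ t, t * X t ∂expMeasure 1 - ∫ t, X t ∂expMeasure 1 := by
    rw [← integral_sub itX iX]
    simp only [sub_mul, one_mul]
  linarith

omit hM in
lemma measurable_indicator_Iic (c : ℝ) : Measurable ((Set.Iic c).indicator (1 : ℝ → ℝ)) :=
  measurable_one.indicator measurableSet_Iic

omit hM in
lemma norm_indicator_Iic_le (c t : ℝ) : ‖(Set.Iic c).indicator (1 : ℝ → ℝ) t‖ ≤ 1 := by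
  by_cases h : t ∈ Set.Iic c <;> simp [h]

omit hM in
lemma integrable_const_mul_indicator_Iic (c : ℝ) :
    Integrable (fun t => c * (Set.Iic c).indicator (1 : ℝ → ℝ) t) (expMeasure 1) :=
  (Integrable.of_bound (measurable_indicator_Iic c).aestronglyMeasurable 1
    (ae_of_all _ (norm_indicator_Iic_le c))).const_mul c

lemma IsBIC.integrable_indicator_pay (l : Fin n) (c : ℝ) :
    Integrable (fun v => (Set.Iic c).indicator 1 (v l) * M.pay v l)
      (valueLaw (expMeasure 1) n) := by
  have m1 := (measurable_indicator_Iic c).comp (measurable_pi_apply (X := fun _ : Fin n => ℝ) l)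
  exact (hM.integrable_pay_valueLaw l).bdd_mul (c := 1) m1.aestronglyMeasurable
    (ae_of_all _ fun v => norm_indicator_Iic_le c (v l))

/-- Bidders with values at most `c` pay on average at most `c` per item. -/
lemma IsBIC.integral_indicator_pay_le (l : Fin n) (c : ℝ) :
    ∫ v, (Set.Iic c).indicator 1 (v l) * M.pay v l ∂valueLaw (expMeasure 1) n ≤
      ∫ v, c * (Set.Iic c).indicator 1 (v l) * expItems M v l ∂valueLaw (expMeasure 1) n := by
  have ic := integrable_const_mul_indicator_Iic c
  rw [integral_mul_expItems M l (g := fun t => c * (Set.Iic c).indicator 1 t) ic,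
    integral_valueLaw_eq l (hM.integrable_indicator_pay l c)]
  simp only [Function.update_self, integral_const_mul]
  change ∫ t, _ * interimPay M (expMeasure 1) l t ∂expMeasure 1 ≤ _
  refine integral_mono_ae ((hM.integrable_interimPay l).bdd_mul (c := 1)
    (measurable_indicator_Iic c).aestronglyMeasurable
    (ae_of_all _ (norm_indicator_Iic_le c))) (ic.mul_bdd (c := 1)
    (measurable_interimItems M l).aestronglyMeasurable (ae_of_all _ fun t => by
      rw [Real.norm_of_nonneg (interimItems_nonneg M l t)]; exact interimItems_le_one M l t)) ?_
  filter_upwards [ae_nonneg_expMeasure_one] with t ht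
  -- For `t ≤ c`, individual rationality gives `P t ≤ t * X t ≤ c * X t`, with `P` and `X` the
  -- interim payment and service probability.
  by_cases h : t ∈ Set.Iic c
  · have h1 := hM.interimPay_le l ht
    have h2 := mul_le_mul_of_nonneg_right (Set.mem_Iic.1 h)
      (interimItems_nonneg M (F := expMeasure 1) l t)
    simp only [h, Set.indicator_of_mem, Pi.one_apply]
    linarith
  · simp [h]

end BIC

/-! ### Revenue bound for separate bidders -/

section RevenueBound

variable {n : ℕ}

lemma ae_values_nonneg : ∀ᵐ v ∂valueLaw (expMeasure 1) n, ∀ i, 0 ≤ v i :=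
  ae_valueLaw_of_forall fun _ => ae_nonneg_expMeasure_one

lemma sum_sub_one_mul_expItems_le (M : Mechanism n n 1) (v : Fin n → ℝ) :
    ∑ l, (v l - 1) * expItems M v l ≤ max (topValue v - 1) 0 := by
  calc ∑ l, (v l - 1) * expItems M v l ≤ ∑ l, max (topValue v - 1) 0 * expItems M v l := by
        refine Finset.sum_le_sum fun l _ =>
          mul_le_mul_of_nonneg_right (le_max_of_le_left ?_) (expItems_nonneg M v l)
        linarith [le_topValue v l]
    _ = max (topValue v - 1) 0 * ∑ l, expItems M v l := by rw [Finset.mul_sum]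
    _ ≤ max (topValue v - 1) 0 :=
        mul_le_of_le_one_right (le_max_right _ _) (sum_expItems_le_one M v)

lemma integrable_max_topValue_sub_one [NeZero n] :
    Integrable (fun v => max (topValue v - 1) 0) (valueLaw (expMeasure 1) n) := by
  have h : Integrable (fun v : Fin n → ℝ => ∑ i, v i) (valueLaw (expMeasure 1) n) :=
    integrable_finsetSum _ fun i _ => integrable_eval_comp i integrable_id_expMeasure_one
  refine h.mono ((measurable_topValue.sub_const 1).max measurable_const).aestronglyMeasurable ?_
  filter_upwards [ae_values_nonneg] with v hv
  have h0 : 0 ≤ ∑ i, v i := Finset.sum_nonneg fun i _ => hv i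
  rw [Real.norm_of_nonneg (le_max_right _ _), Real.norm_of_nonneg h0]
  obtain ⟨i, hi⟩ := exists_eq_topValue v
  have := Finset.single_le_sum (fun i _ => hv i) (Finset.mem_univ i)
  exact max_le (by linarith) h0

lemma integrable_sub_one_mul_expItems (M : Mechanism n n 1) (l : Fin n) :
    Integrable (fun v => (v l - 1) * expItems M v l) (valueLaw (expMeasure 1) n) :=
  integrable_mul_expItems M l (g := fun t => t - 1)
    (integrable_id_expMeasure_one.sub (integrable_const 1))

lemma IsBIC.integral_sum_pay_le {M : Mechanism n n 1}
    (hM : IsBIC (expMeasure 1) (competition n) M) :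
    ∫ v, ∑ l, M.pay v l ∂valueLaw (expMeasure 1) n ≤
      ∫ v, ∑ l, (v l - 1) * expItems M v l ∂valueLaw (expMeasure 1) n := by
  rw [integral_finsetSum _ fun l _ => hM.integrable_pay_valueLaw l,
    integral_finsetSum _ fun l _ => integrable_sub_one_mul_expItems M l]
  exact Finset.sum_le_sum fun l _ => hM.integral_pay_le l

lemma integral_sum_sub_one_mul_expItems_le [NeZero n] (M : Mechanism n n 1) :
    ∫ v, ∑ l, (v l - 1) * expItems M v l ∂valueLaw (expMeasure 1) n ≤
      ∫ v, max (topValue v - 1) 0 ∂valueLaw (expMeasure 1) n :=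
  integral_mono (integrable_finsetSum _ fun l _ => integrable_sub_one_mul_expItems M l)
    integrable_max_topValue_sub_one (sum_sub_one_mul_expItems_le M)

end RevenueBound

/-! ### The second-price auction with reserve price `1` -/

section SecondPrice

variable {n : ℕ}

/-- The highest of the reserve price `1` and the reports of the bidders other than `l`. -/
noncomputable def threshold (b : Fin n → ℝ) (l : Fin n) : ℝ := topValue (Function.update b l 1)

lemma one_le_threshold (b : Fin n → ℝ) (l : Fin n) : 1 ≤ threshold b l := by
  simpa [threshold] using le_topValue (Function.update b l 1) l

lemma le_threshold (b : Fin n → ℝ) {l j : Fin n} (h : j ≠ l) : b j ≤ threshold b l := by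
  simpa [threshold, h] using le_topValue (Function.update b l 1) j

lemma threshold_le [NeZero n] {b : Fin n → ℝ} {l : Fin n} {c : ℝ} (h1 : 1 ≤ c)
    (h : ∀ j, j ≠ l → b j ≤ c) : threshold b l ≤ c := by
  refine ciSup_le fun j => ?_
  by_cases hj : j = l
  · subst hj; simpa using h1
  · simpa [hj] using h j hj

lemma threshold_lt [NeZero n] {b : Fin n → ℝ} {l : Fin n} {c : ℝ} (h1 : 1 < c)
    (h : ∀ j, j ≠ l → b j < c) : threshold b l < c := by
  obtain ⟨j, hj⟩ := exists_eq_topValue (Function.update b l 1)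
  rw [threshold, ← hj]
  by_cases hjl : j = l
  · subst hjl; simpa using h1
  · simpa [hjl] using h j hjl

lemma threshold_update (w : Fin n → ℝ) (l : Fin n) (t : ℝ) :
    threshold (Function.update w l t) l = threshold w l := by
  simp [threshold]

lemma measurable_threshold (l : Fin n) : Measurable fun b : Fin n → ℝ => threshold b l :=
  measurable_topValue.comp (measurable_update_const l 1)

lemma measurableSet_threshold_lt (l : Fin n) :
    MeasurableSet {b : Fin n → ℝ | threshold b l < b l} :=
  measurableSet_lt (measurable_threshold l) (measurable_pi_apply l)

/-- The allocation that serves the bidders who report more than their threshold. -/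
noncomputable def secondPriceAllocation (b : Fin n → ℝ) (l : Fin n) : Fin 2 :=
  if threshold b l < b l then 1 else 0

lemma measurable_secondPriceAllocation :
    Measurable (secondPriceAllocation : (Fin n → ℝ) → Fin n → Fin 2) :=
  measurable_pi_lambda _ fun l =>
    Measurable.ite (measurableSet_threshold_lt l) measurable_const measurable_const

/-- Each threshold dominates all other reports, so two bidders cannot both strictly exceed theirs.
-/
lemma sum_secondPriceAllocation_le (b : Fin n → ℝ) :
    ∑ l, (secondPriceAllocation b l : ℕ) ≤ 1 := by
  by_cases h : ∃ l, threshold b l < b l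
  · obtain ⟨l, hl⟩ := h
    rw [Finset.sum_eq_single l]
    · omega
    · intro j _ hj
      have h1 := le_threshold b hj
      have h2 := le_threshold b hj.symm
      have : ¬ threshold b j < b j := by linarith
      simp [secondPriceAllocation, this]
    · simp
  · push Not at h
    simp [secondPriceAllocation, not_lt.2 (h _)]

/-- The second-price auction with reserve price `1`; the item stays unsold in case of a tie. -/
noncomputable def secondPrice (n : ℕ) : Mechanism n n 1 where
  alloc b a := if a = secondPriceAllocation b then 1 else 0
  pay b l := if threshold b l < b l then threshold b l else 0
  alloc_nonneg b a := by split_ifs <;> simp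
  alloc_sum b := by simp
  feasible b a h := by
    have : a = secondPriceAllocation b := by
      by_contra h'
      exact h (if_neg h')
    rw [this]
    exact sum_secondPriceAllocation_le b
  pay_nonneg b l := by
    split_ifs
    · linarith [one_le_threshold b l]
    · exact le_rfl
  measurable_alloc a := by
    refine Measurable.ite ?_ measurable_const measurable_const
    have : {b : Fin n → ℝ | a = secondPriceAllocation b} = secondPriceAllocation ⁻¹' {a} := by
      ext b; simp [eq_comm]
    rw [this]
    exact measurable_secondPriceAllocation (measurableSet_singleton a)
  measurable_pay l :=
    Measurable.ite (measurableSet_threshold_lt l) (measurable_threshold l) measurable_const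

lemma secondPrice_pay (b : Fin n → ℝ) (l : Fin n) :
    (secondPrice n).pay b l = if threshold b l < b l then threshold b l else 0 := rfl

lemma expItems_secondPrice (b : Fin n → ℝ) (l : Fin n) :
    expItems (secondPrice n) b l = if threshold b l < b l then 1 else 0 := by
  simp only [expItems, secondPrice, ite_mul, one_mul, zero_mul, Finset.sum_ite_eq',
    Finset.mem_univ, if_true, secondPriceAllocation]
  split_ifs <;> simp

lemma secondPrice_pay_update (w : Fin n → ℝ) (l : Fin n) (t : ℝ) :
    (secondPrice n).pay (Function.update w l t) l =
      if threshold w l < t then threshold w l else 0 := by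
  simp [secondPrice_pay, threshold_update]

lemma expItems_secondPrice_update (w : Fin n → ℝ) (l : Fin n) (t : ℝ) :
    expItems (secondPrice n) (Function.update w l t) l =
      if threshold w l < t then 1 else 0 := by
  simp [expItems_secondPrice, threshold_update]

lemma integrable_secondPrice_pay_update (l : Fin n) (t : ℝ) :
    Integrable (fun w => (secondPrice n).pay (Function.update w l t) l)
      (valueLaw (expMeasure 1) n) := by
  refine Integrable.of_bound (((secondPrice n).measurable_pay l).comp
    (measurable_update_const l t)).aestronglyMeasurable |t| (ae_of_all _ fun w => ?_)
  rw [Real.norm_of_nonneg ((secondPrice n).pay_nonneg _ l), secondPrice_pay_update]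
  split_ifs with h
  · exact h.le.trans (le_abs_self t)
  · exact abs_nonneg t

/-- A bidder's threshold does not depend on her own report, so truth is optimal for each fixed `w`;
the interim statements follow by integration. -/
lemma isBIC_secondPrice : IsBIC (expMeasure 1) (competition n) (secondPrice n) where
  integrable_pay l b _ := by
    simp only [mergeReports_competition]
    exact integrable_secondPrice_pay_update l (b l)
  ic l v hv b _ := by
    have hvl := mem_typeSpace_expMeasure_one.1 hv l
    rw [interimUtility_competition _ l hvl, interimUtility_competition _ l hvl]
    refine integral_mono
      (((integrable_expItems_comp _ l (measurable_update_const l _)).const_mul _).sub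
        (integrable_secondPrice_pay_update l _))
      (((integrable_expItems_comp _ l (measurable_update_const l _)).const_mul _).sub
        (integrable_secondPrice_pay_update l _)) fun w => ?_
    simp only [expItems_secondPrice_update, secondPrice_pay_update]
    split_ifs <;> linarith
  ir l v hv := by
    have hvl := mem_typeSpace_expMeasure_one.1 hv l
    rw [interimUtility_competition _ l hvl]
    refine integral_nonneg fun w => ?_
    simp only [expItems_secondPrice_update, secondPrice_pay_update, Pi.zero_apply]
    split_ifs <;> linarith

/-- Myerson's bound is an equality here: with the others' values fixed, the winner's virtual value
minus the threshold has mean zero. -/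
lemma integral_secondPrice_pay (l : Fin n) :
    ∫ v, (secondPrice n).pay v l ∂valueLaw (expMeasure 1) n =
      ∫ v, (v l - 1) * expItems (secondPrice n) v l ∂valueLaw (expMeasure 1) n := by
  have i1 := isBIC_secondPrice.integrable_pay_valueLaw l
  have i2 := integrable_sub_one_mul_expItems (secondPrice n) l
  rw [eq_comm, ← sub_eq_zero, ← integral_sub i2 i1,
    integral_valueLaw_eq_swap l (f := fun v => (v l - 1) * expItems (secondPrice n) v l -
      (secondPrice n).pay v l) (i2.sub i1)]
  refine integral_eq_zero_of_ae (ae_of_all _ fun w => ?_)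
  have h0 : 0 ≤ threshold w l := zero_le_one.trans (one_le_threshold w l)
  rw [Pi.zero_apply, ← integral_virtual_value_sub_price h0]
  refine integral_congr_ae (ae_of_all _ fun t => ?_)
  simp only [Function.update_self, Set.indicator_apply, Set.mem_Ioi, expItems_secondPrice_update,
    secondPrice_pay_update]
  split_ifs <;> ring

/-- Ties, in which the second-price auction keeps the item, are negligible because the exponential
law has no atoms. -/
lemma ae_values_ne {i j : Fin n} (hij : i ≠ j) :
    ∀ᵐ v ∂valueLaw (expMeasure 1) n, v i ≠ v j := by
  have h := measurePreserving_update (F := expMeasure 1) i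
  have hm : MeasurableSet {v : Fin n → ℝ | v i ≠ v j} :=
    (measurableSet_eq_fun (measurable_pi_apply i) (measurable_pi_apply j)).compl
  rw [← h.map_eq, ae_map_iff h.measurable.aemeasurable hm]
  refine (Measure.ae_prod_iff_ae_ae (h.measurable hm)).2 ?_
  refine ae_of_all _ fun t => ?_
  have := Measure.ae_eval_ne (μ := fun _ : Fin n => expMeasure 1) j t
  filter_upwards [this] with w hw
  simpa [hij.symm] using hw.symm

lemma ae_sum_expItems_secondPrice [NeZero n] :
    ∀ᵐ v ∂valueLaw (expMeasure 1) n,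
      ∑ l, (v l - 1) * expItems (secondPrice n) v l = max (topValue v - 1) 0 := by
  have h : ∀ᵐ v ∂valueLaw (expMeasure 1) n, ∀ i j : Fin n, i ≠ j → v i ≠ v j :=
    ae_all_iff.2 fun i => ae_all_iff.2 fun j => by
      by_cases hij : i = j
      · simp [hij]
      · simpa [hij] using ae_values_ne hij
  filter_upwards [h] with v hv
  obtain ⟨i, hi⟩ := exists_eq_topValue v
  by_cases h1 : 1 < topValue v
  · have hlt : ∀ j, j ≠ i → v j < v i := fun j hj =>
      lt_of_le_of_ne (hi ▸ le_topValue v j) (hv j i hj)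
    rw [max_eq_left (by linarith), Finset.sum_eq_single i]
    · rw [expItems_secondPrice, if_pos (threshold_lt (hi ▸ h1) hlt), mul_one, hi]
    · intro j _ hj
      have : ¬ threshold v j < v j := not_lt.2 ((hlt j hj).le.trans (le_threshold v hj.symm))
      rw [expItems_secondPrice, if_neg this, mul_zero]
    · simp
  · rw [max_eq_right (by linarith)]
    refine Finset.sum_eq_zero fun l _ => ?_
    have : ¬ threshold v l < v l := by
      have := le_topValue v l
      have := one_le_threshold v l
      linarith
    rw [expItems_secondPrice, if_neg this, mul_zero]

lemma integral_sum_secondPrice_pay [NeZero n] :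
    ∫ v, ∑ l, (secondPrice n).pay v l ∂valueLaw (expMeasure 1) n =
      ∫ v, max (topValue v - 1) 0 ∂valueLaw (expMeasure 1) n := by
  rw [← integral_congr_ae ae_sum_expItems_secondPrice,
    integral_finsetSum _ fun l _ => isBIC_secondPrice.integrable_pay_valueLaw l,
    integral_finsetSum _ fun l _ => integrable_sub_one_mul_expItems _ l]
  exact Finset.sum_congr rfl fun l _ => integral_secondPrice_pay l

lemma optRevenue_competition [NeZero n] :
    optRevenue (expMeasure 1) 1 (competition n) =
      ENNReal.ofReal (∫ v, max (topValue v - 1) 0 ∂valueLaw (expMeasure 1) n) := by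
  apply le_antisymm
  · refine iSup₂_le fun M hM => ?_
    rw [hM.revenue_eq]
    exact ENNReal.ofReal_le_ofReal
      (hM.integral_sum_pay_le.trans (integral_sum_sub_one_mul_expItems_le M))
  · rw [← integral_sum_secondPrice_pay, ← isBIC_secondPrice.revenue_eq]
    exact le_iSup₂_of_le (secondPrice n) isBIC_secondPrice le_rfl

lemma isOptimalMechanism_secondPrice [NeZero n] :
    IsOptimalMechanism (expMeasure 1) (competition n) (secondPrice n) :=
  ⟨isBIC_secondPrice, by
    rw [optRevenue_competition, isBIC_secondPrice.revenue_eq, integral_sum_secondPrice_pay]⟩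

end SecondPrice

/-! ### The second-price auction under monopsony -/

section SecondPriceMonopsony

variable {n : ℕ} [NeZero n]

/-- Demand the item at the reserve price if some buyer's value covers it, else stay out. -/
noncomputable def reserveStrategy (v : Fin n → ℝ) : MonopsonyAction n :=
  if 1 ≤ topValue v then Sum.inl (Pi.single 0 2) else Sum.inr ()

lemma measurable_reserveStrategy : Measurable (reserveStrategy : (Fin n → ℝ) → _) :=
  Measurable.ite (measurableSet_le measurable_const measurable_topValue)
    measurable_const measurable_const

/-- Thresholds are at least `1`, so no combination of reports buys the item below the reserve. -/
lemma secondPrice_payoff_inl_le {v : Fin n → ℝ} (hv : ∀ i, 0 ≤ v i) (b : Fin n → ℝ) :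
    monopsonyPayoff (secondPrice n) v (Sum.inl b) ≤ max (topValue v - 1) 0 := by
  rw [monopsonyPayoff_inl _ hv]
  have hpay : ∑ l, expItems (secondPrice n) b l ≤ ∑ l, (secondPrice n).pay b l := by
    refine Finset.sum_le_sum fun l _ => ?_
    rw [expItems_secondPrice, secondPrice_pay]
    split_ifs
    · exact one_le_threshold b l
    · exact le_rfl
  have h0 : 0 ≤ ∑ l, expItems (secondPrice n) b l :=
    Finset.sum_nonneg fun l _ => expItems_nonneg _ b l
  calc _ ≤ (topValue v - 1) * ∑ l, expItems (secondPrice n) b l := by linarith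
    _ ≤ max (topValue v - 1) 0 * ∑ l, expItems (secondPrice n) b l := by
        gcongr; exact le_max_left _ _
    _ ≤ max (topValue v - 1) 0 :=
        mul_le_of_le_one_right (le_max_right _ _) (sum_expItems_le_one _ b)

/-- A single report above the reserve, with zeros elsewhere, removes all competition and wins at
exactly `1`. Any number above `1` could replace `2`. -/
lemma secondPrice_payoff_single {v : Fin n → ℝ} (hv : ∀ i, 0 ≤ v i) :
    monopsonyPayoff (secondPrice n) v (Sum.inl (Pi.single 0 2)) = topValue v - 1 := by
  have h0 : threshold (Pi.single 0 2 : Fin n → ℝ) 0 = 1 :=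
    le_antisymm (threshold_le le_rfl fun j hj => by simp [hj]) (one_le_threshold _ _)
  have hj : ∀ j : Fin n, j ≠ 0 → ¬ threshold (Pi.single 0 2 : Fin n → ℝ) j <
      (Pi.single 0 2 : Fin n → ℝ) j := fun j hj => by
    have := one_le_threshold (Pi.single 0 2 : Fin n → ℝ) j
    simp only [Pi.single_eq_of_ne hj, not_lt]
    linarith
  rw [monopsonyPayoff_inl _ hv, Finset.sum_eq_single 0, Finset.sum_eq_single 0,
    expItems_secondPrice, secondPrice_pay, h0]
  · simp
  · intro j _ h; rw [secondPrice_pay, if_neg (hj j h)]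
  · simp
  · intro j _ h; rw [expItems_secondPrice, if_neg (hj j h)]
  · simp

lemma isBestResponse_reserveStrategy {v : Fin n → ℝ} (hv : ∀ i, 0 ≤ v i) :
    IsBestResponse (expMeasure 1) (secondPrice n) v (reserveStrategy v) := by
  have hpay : monopsonyPayoff (secondPrice n) v (reserveStrategy v) =
      max (topValue v - 1) 0 := by
    unfold reserveStrategy
    split_ifs with h
    · rw [secondPrice_payoff_single hv, max_eq_left (by linarith)]
    · rw [max_eq_right (by linarith)]; rfl
  refine ⟨fun b hb => ?_, fun c' _ => ?_⟩
  · unfold reserveStrategy at hb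
    split_ifs at hb
    rw [← Sum.inl.inj hb, mem_typeSpace_expMeasure_one]
    intro i
    by_cases h : i = 0
    · subst h; simp
    · simp [h]
  · rw [hpay]
    rcases c' with b | u
    · exact secondPrice_payoff_inl_le hv b
    · exact le_max_right _ _

lemma isMonopsonyEquilibrium_reserveStrategy :
    IsMonopsonyEquilibrium (expMeasure 1) (secondPrice n)
      (Kernel.deterministic reserveStrategy measurable_reserveStrategy) := by
  refine ⟨inferInstance, ?_⟩
  filter_upwards [ae_values_nonneg] with v hv
  have hs : MeasurableSet ({reserveStrategy v} : Set (MonopsonyAction n)) := by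
    rcases reserveStrategy v with b | u
    · rw [← Set.image_singleton]
      exact (measurableSet_singleton b).inl_image
    · rw [← Set.image_singleton]
      exact (measurableSet_singleton u).inr_image
  rw [Kernel.deterministic_apply]
  filter_upwards [(mem_ae_dirac_iff hs).2 rfl] with c hc
  rw [Set.mem_singleton_iff.1 hc]
  exact isBestResponse_reserveStrategy hv

end SecondPriceMonopsony

/-! ### Optimal mechanisms for competition offer the item cheaply -/

section CheapReport

variable {n : ℕ}

lemma expItems_of_one_lt_topValue {M : Mechanism n n 1} {v : Fin n → ℝ}
    (h : ∑ l, (v l - 1) * expItems M v l = max (topValue v - 1) 0) (h1 : 1 < topValue v) :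
    ∑ l, expItems M v l = 1 ∧ ∀ l, v l < topValue v → expItems M v l = 0 := by
  rw [max_eq_left (by linarith)] at h
  have hn : ∀ l ∈ Finset.univ, 0 ≤ (topValue v - v l) * expItems M v l := fun l _ =>
    mul_nonneg (sub_nonneg.2 (le_topValue v l)) (expItems_nonneg M v l)
  -- The shortfall from the virtual-value bound splits into two nonnegative parts, misallocation and
  -- unsold probability; both must vanish.
  have e : ∑ l, (topValue v - v l) * expItems M v l +
      (topValue v - 1) * (1 - ∑ l, expItems M v l) = 0 := by
    have : ∑ l, (topValue v - v l) * expItems M v l = (topValue v - 1) * ∑ l, expItems M v l -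
        ∑ l, (v l - 1) * expItems M v l := by
      rw [Finset.mul_sum, ← Finset.sum_sub_distrib]
      exact Finset.sum_congr rfl fun l _ => by ring
    rw [this, h]
    ring
  have hs := Finset.sum_nonneg hn
  have hp : 0 ≤ (topValue v - 1) * (1 - ∑ l, expItems M v l) :=
    mul_nonneg (by linarith) (sub_nonneg.2 (sum_expItems_le_one M v))
  constructor
  · rcases mul_eq_zero.1 (show (topValue v - 1) * (1 - ∑ l, expItems M v l) = 0 by linarith)
      with h' | h' <;> linarith
  · intro l hl
    have := (Finset.sum_eq_zero_iff_of_nonneg hn).1 (by linarith) l (Finset.mem_univ l)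
    exact (mul_eq_zero.1 this).resolve_left (by linarith)

lemma expItems_of_topValue_lt_one {M : Mechanism n n 1} {v : Fin n → ℝ}
    (h : ∑ l, (v l - 1) * expItems M v l = max (topValue v - 1) 0) (h1 : topValue v < 1)
    (l : Fin n) : expItems M v l = 0 := by
  rw [max_eq_right (by linarith)] at h
  have hlt : ∀ l, v l < 1 := fun l => (le_topValue v l).trans_lt h1
  have := (Finset.sum_eq_zero_iff_of_nonpos fun l _ =>
    mul_nonpos_of_nonpos_of_nonneg (by linarith [hlt l]) (expItems_nonneg M v l)).1 h l
      (Finset.mem_univ l)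
  exact (mul_eq_zero.1 this).resolve_left (by linarith [hlt l])

variable [NeZero n]

/-- An optimal mechanism almost surely sells to a buyer with the highest virtual value. -/
lemma IsOptimalMechanism.ae_sum_expItems {M : Mechanism n n 1}
    (hM : IsOptimalMechanism (expMeasure 1) (competition n) M) :
    ∀ᵐ v ∂valueLaw (expMeasure 1) n,
      ∑ l, (v l - 1) * expItems M v l = max (topValue v - 1) 0 := by
  have h := hM.2
  rw [optRevenue_competition, hM.1.revenue_eq] at h
  replace h := (ENNReal.ofReal_eq_ofReal_iff
    (integral_nonneg fun v => Finset.sum_nonneg fun l _ => M.pay_nonneg v l)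
    (integral_nonneg fun v => le_max_right _ _)).1 h
  refine (integral_eq_iff_of_ae_le
    (integrable_finsetSum _ fun l _ => integrable_sub_one_mul_expItems M l)
    integrable_max_topValue_sub_one (ae_of_all _ (sum_sub_one_mul_expItems_le M))).1 ?_
  exact le_antisymm (integral_sum_sub_one_mul_expItems_le M) (h ▸ hM.1.integral_sum_pay_le)

/-- Every optimal mechanism for competition surely sells the item at some admissible reports for
a total payment of at most `2`. -/
lemma IsOptimalMechanism.exists_cheap_report {M : Mechanism n n 1}
    (hM : IsOptimalMechanism (expMeasure 1) (competition n) M) :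
    ∃ b : Fin n → ℝ, (∀ i, 0 ≤ b i) ∧ ∑ l, expItems M b l = 1 ∧ ∑ l, M.pay b l ≤ 2 := by
  by_contra! hcon
  set ι : ℝ → ℝ := (Set.Iic 2).indicator 1
  -- The excess, over a price of `2` per item, of what bidders with values at most `2` pay. Its mean
  -- is at most `0`, while the negated claim makes it nonnegative, and positive on an event of
  -- positive probability.
  set g : (Fin n → ℝ) → ℝ := fun v =>
    ∑ l, (ι (v l) * M.pay v l - 2 * ι (v l) * expItems M v l)
  have i1 : ∀ l, Integrable (fun v => ι (v l) * M.pay v l) (valueLaw (expMeasure 1) n) :=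
    fun l => hM.1.integrable_indicator_pay l 2
  have i2 : ∀ l, Integrable (fun v => 2 * ι (v l) * expItems M v l)
      (valueLaw (expMeasure 1) n) := fun l =>
    integrable_mul_expItems M l (integrable_const_mul_indicator_Iic 2)
  have ig : Integrable g (valueLaw (expMeasure 1) n) :=
    integrable_finsetSum _ fun l _ => (i1 l).sub (i2 l)
  have hg : ∫ v, g v ∂valueLaw (expMeasure 1) n ≤ 0 := by
    refine (integral_finsetSum _ fun l _ => (i1 l).sub (i2 l)).trans_le ?_
    refine Finset.sum_nonpos fun l _ => ?_
    refine (integral_sub (i1 l) (i2 l)).trans_le ?_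
    exact sub_nonpos.2 (hM.1.integral_indicator_pay_le l 2)
  have hι0 : ∀ t, 0 ≤ ι t := fun t => Set.indicator_nonneg (fun _ _ => zero_le_one) t
  -- A top value of exactly `1` has virtual value `0`, where optimality does not determine the
  -- allocation.
  have hne : ∀ᵐ v ∂valueLaw (expMeasure 1) n, ∀ i, v i ≠ 1 :=
    ae_valueLaw_of_forall fun _ => Measure.ae_ne _ 1
  have hpos : ∀ᵐ v ∂valueLaw (expMeasure 1) n,
      0 ≤ g v ∧ (1 < topValue v → topValue v ≤ 2 → 0 < g v) := by
    filter_upwards [ae_values_nonneg, hne, hM.ae_sum_expItems] with v hv hv1 hsum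
    obtain ⟨i, hi⟩ := exists_eq_topValue v
    have hgood : 1 < topValue v → topValue v ≤ 2 → 0 < g v := by
      intro h1 h2
      have hq := (expItems_of_one_lt_topValue hsum h1).1
      have hι : ∀ l, ι (v l) = 1 := fun l =>
        Set.indicator_of_mem (Set.mem_Iic.2 ((le_topValue v l).trans h2)) _
      have : g v = ∑ l, M.pay v l - 2 * ∑ l, expItems M v l := by
        simp only [g, hι, one_mul, mul_one, Finset.sum_sub_distrib, Finset.mul_sum]
      rw [this, hq]
      linarith [hcon v hv hq]
    refine ⟨?_, hgood⟩
    -- If no bidder with value at most `2` gets items, `g` is a sum of payments. This covers top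
    -- values below `1` (no sale) and above `2` (only highest bidders are served).
    have hrest : (∀ l, ι (v l) * expItems M v l = 0) → 0 ≤ g v := fun h =>
      Finset.sum_nonneg fun l _ => by
        rw [mul_assoc, h l, mul_zero, sub_zero]
        exact mul_nonneg (hι0 _) (M.pay_nonneg v l)
    rcases lt_or_gt_of_ne (hi ▸ hv1 i) with h1 | h1
    · exact hrest fun l => by rw [expItems_of_topValue_lt_one hsum h1 l, mul_zero]
    · rcases le_or_gt (topValue v) 2 with h2 | h2
      · exact (hgood h1 h2).le
      · refine hrest fun l => ?_
        by_cases hl : v l ≤ 2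
        · rw [(expItems_of_one_lt_topValue hsum h1).2 l (hl.trans_lt h2), mul_zero]
        · rw [show ι (v l) = 0 from Set.indicator_of_notMem (by simpa using hl) _, zero_mul]
  have hg0 : 0 ≤ᵐ[valueLaw (expMeasure 1) n] g := hpos.mono fun v h => h.1
  have hzero := (integral_eq_zero_iff_of_nonneg_ae hg0 ig).1
    (le_antisymm hg (integral_nonneg_of_ae hg0))
  have hbox : valueLaw (expMeasure 1) n (Set.univ.pi fun _ => Set.Ioo 1 2) = 0 := by
    rw [measure_eq_zero_iff_ae_notMem]
    filter_upwards [hpos, hzero] with v h1 h2 hmem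
    obtain ⟨i, hi⟩ := exists_eq_topValue v
    have := hmem i (Set.mem_univ i)
    have := h1.2 (hi ▸ this.1) (hi ▸ this.2.le)
    simp only [Pi.zero_apply] at h2
    linarith
  rw [valueLaw, Measure.pi_pi, Finset.prod_eq_zero_iff] at hbox
  obtain ⟨_, _, h⟩ := hbox
  exact (expMeasure_one_Ioo_pos zero_le_one one_lt_two).ne' h

/-- In every equilibrium of an optimal mechanism for competition, the monopsonist pays at
most `2`. -/
lemma IsOptimalMechanism.monopsonyRevenue_le {M : Mechanism n n 1}
    (hM : IsOptimalMechanism (expMeasure 1) (competition n) M)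
    {σ : Kernel (Fin n → ℝ) (MonopsonyAction n)}
    (hσ : IsMonopsonyEquilibrium (expMeasure 1) M σ) :
    monopsonyRevenue (expMeasure 1) M σ ≤ ENNReal.ofReal 2 := by
  obtain ⟨b, hb0, hbq, hbp⟩ := hM.exists_cheap_report
  have := hσ.1
  calc monopsonyRevenue (expMeasure 1) M σ
      ≤ ∫⁻ v, ∫⁻ _, ENNReal.ofReal 2 ∂(σ v) ∂(valueLaw (expMeasure 1) n) := by
        refine lintegral_mono_ae ?_
        filter_upwards [hσ.2, ae_values_nonneg] with v hv hv0
        refine lintegral_mono_ae ?_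
        filter_upwards [hv] with c hc
        refine ENNReal.ofReal_le_ofReal ?_
        rcases c with c | c
        -- Deviating to the cheap report gives at least `topValue v - 2`, while `c` gives at most
        -- `topValue v` minus its payment.
        · have h := hc.2 (Sum.inl b) fun b' hb' => by
            rw [← Sum.inl.inj hb']
            exact mem_typeSpace_expMeasure_one.2 hb0
          rw [monopsonyPayoff_inl M hv0, monopsonyPayoff_inl M hv0, hbq] at h
          have h1 := mul_le_mul_of_nonneg_left (sum_expItems_le_one M c) (topValue_nonneg hv0)
          change ∑ l, M.pay c l ≤ 2
          linarith
        · exact zero_le_two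
    _ = ENNReal.ofReal 2 := by simp

end CheapReport

/-! ### Revenue under monopsony -/

section PostedPrice

variable {n : ℕ}

lemma measurableSet_le_topValue (p : ℝ) : MeasurableSet {b : Fin n → ℝ | p ≤ topValue b} :=
  measurableSet_le measurable_const measurable_topValue

/-- The item is offered to the monopsonist at the price `p`. -/
noncomputable def postedPrice (n : ℕ) (p : ℝ) (hp : 0 ≤ p) : Mechanism n 1 1 where
  alloc b a := if a = fun _ => if p ≤ topValue b then 1 else 0 then 1 else 0
  pay b _ := if p ≤ topValue b then p else 0
  alloc_nonneg b a := by split_ifs <;> simp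
  alloc_sum b := by simp
  feasible b a _ := by
    rw [Finset.univ_unique, Finset.sum_singleton]
    exact Nat.lt_succ_iff.1 (a _).2
  pay_nonneg b l := by split_ifs <;> simp [hp]
  measurable_alloc a := by
    have : (fun b : Fin n → ℝ =>
        if a = (fun _ => if p ≤ topValue b then 1 else 0) then (1 : ℝ) else 0) = fun b =>
        if p ≤ topValue b then (if a = fun _ => 1 then 1 else 0)
        else if a = fun _ => 0 then 1 else 0 := by
      ext b
      by_cases h : p ≤ topValue b <;> simp [h]
    rw [this]
    exact Measurable.ite (measurableSet_le_topValue p) measurable_const measurable_const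
  measurable_pay _ :=
    Measurable.ite (measurableSet_le_topValue p) measurable_const measurable_const

lemma interimUtility_postedPrice [NeZero n] {p : ℝ} (hp : 0 ≤ p) (l : Fin 1) {v : Fin n → ℝ}
    (hv : ∀ i, 0 ≤ v i) (b : Fin n → ℝ) :
    interimUtility (expMeasure 1) (monopsony n) (postedPrice n p hp) l v b =
      if p ≤ topValue b then topValue v - p else 0 := by
  obtain rfl : l = 0 := Subsingleton.elim _ _
  simp only [interimUtility, mergeReports_monopsony, integral_const, probReal_univ, one_smul,
    postedPrice, ite_mul, one_mul, zero_mul, Finset.sum_ite_eq', Finset.mem_univ, if_true]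
  split_ifs
  · rw [surplus_monopsony (by simp) hv]; simp
  · rw [surplus_monopsony (by simp) hv]; simp

lemma isBIC_postedPrice [NeZero n] {p : ℝ} (hp : 0 ≤ p) :
    IsBIC (expMeasure 1) (monopsony n) (postedPrice n p hp) where
  integrable_pay l b _ := by
    obtain rfl : l = 0 := Subsingleton.elim _ _
    simp only [mergeReports_monopsony]
    exact integrable_const _
  ic l v hv b _ := by
    have hv' := mem_typeSpace_expMeasure_one.1 hv
    rw [interimUtility_postedPrice hp l hv', interimUtility_postedPrice hp l hv']
    split_ifs <;> linarith
  ir l v hv := by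
    rw [interimUtility_postedPrice hp l (mem_typeSpace_expMeasure_one.1 hv)]
    split_ifs <;> linarith

lemma revenue_postedPrice {F : Measure ℝ} {p : ℝ} (hp : 0 ≤ p) :
    revenue F (postedPrice n p hp) =
      ENNReal.ofReal p * valueLaw F n {v | p ≤ topValue v} := by
  rw [revenue, ← lintegral_indicator_const (measurableSet_le_topValue p)]
  refine lintegral_congr fun v => ?_
  by_cases h : p ≤ topValue v <;> simp [postedPrice, h]

lemma valueLaw_topValue_lt [NeZero n] {F : Measure ℝ} [IsProbabilityMeasure F] (p : ℝ) :
    valueLaw F n {v | topValue v < p} = F (Set.Iio p) ^ n := by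
  have : {v : Fin n → ℝ | topValue v < p} = Set.univ.pi fun _ => Set.Iio p := by
    ext v
    simp only [Set.mem_ofPred_eq, Set.mem_univ_pi, Set.mem_Iio]
    constructor
    · exact fun h i => (le_topValue v i).trans_lt h
    · intro h
      obtain ⟨i, hi⟩ := exists_eq_topValue v
      exact hi ▸ h i
  rw [this, valueLaw, Measure.pi_pi]
  simp

/-- The posted price `p` fails to sell only if all `n` independent values are below `p`. -/
lemma le_optRevenue_monopsony [NeZero n] {p : ℝ} (hp : 0 ≤ p) :
    ENNReal.ofReal p * (1 - expMeasure 1 (Set.Iio p) ^ n) ≤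
      optRevenue (expMeasure 1) 1 (monopsony n) := by
  refine le_iSup₂_of_le (postedPrice n p hp) (isBIC_postedPrice hp) ?_
  rw [revenue_postedPrice, ← valueLaw_topValue_lt p, ← prob_compl_eq_one_sub
    (measurableSet_lt measurable_topValue measurable_const)]
  gcongr
  intro v hv
  simpa using hv

lemma expMeasure_one_Iio_lt_one {p : ℝ} (hp : 0 ≤ p) : expMeasure 1 (Set.Iio p) < 1 := by
  refine lt_of_le_of_ne prob_le_one fun h => ?_
  have h1 := (prob_compl_eq_zero_iff (μ := expMeasure 1) measurableSet_Iio).2 h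
  refine (expMeasure_one_Ioo_pos hp (lt_add_one p)).ne' (measure_mono_null (fun t ht => ?_) h1)
  simpa using ht.1.le

end PostedPrice

theorem mainTheorem8 (γ : ℝ) (hγ : 0 < γ) :
    ∃ (n k : ℕ) (F : Measure ℝ), k = 1 ∧ F = expMeasure 1 ∧
      (∃ (M : Mechanism n n k) (σ : Kernel (Fin n → ℝ) (MonopsonyAction n)),
        IsOptimalMechanism F (competition n) M ∧ IsMonopsonyEquilibrium F M σ) ∧
      ∀ M : Mechanism n n k, IsOptimalMechanism F (competition n) M →
        ∀ σ : Kernel (Fin n → ℝ) (MonopsonyAction n), IsMonopsonyEquilibrium F M σ →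
          monopsonyRevenue F M σ < ENNReal.ofReal γ * optRevenue F k (monopsony n) := by
  -- At the price `6 / γ`, choose `n` so that a sale has probability at least `1 / 2`. Then `γ`
  -- times the monopsony optimum is at least `3`, above the bound `2`.
  have hp : (0 : ℝ) ≤ 6 / γ := by positivity
  have hlim := ENNReal.tendsto_pow_atTop_nhds_zero_of_lt_one (expMeasure_one_Iio_lt_one hp)
  obtain ⟨n, hn, hn0⟩ := ((hlim.eventually_le_const (u := 2⁻¹) (by simp)).and
    (Filter.eventually_gt_atTop 0)).exists
  have : NeZero n := ⟨hn0.ne'⟩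
  refine ⟨n, 1, expMeasure 1, rfl, rfl, ⟨secondPrice n, _, isOptimalMechanism_secondPrice,
    isMonopsonyEquilibrium_reserveStrategy⟩, fun M hM σ hσ => ?_⟩
  calc monopsonyRevenue (expMeasure 1) M σ ≤ ENNReal.ofReal 2 := hM.monopsonyRevenue_le hσ
    _ < ENNReal.ofReal 3 := (ENNReal.ofReal_lt_ofReal_iff (by norm_num)).2 (by norm_num)
    _ = ENNReal.ofReal γ * (ENNReal.ofReal (6 / γ) * ENNReal.ofReal (2⁻¹)) := by
        rw [← ENNReal.ofReal_mul hp, ← ENNReal.ofReal_mul hγ.le]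
        congr 1
        field_simp
        norm_num
    _ ≤ ENNReal.ofReal γ *
        (ENNReal.ofReal (6 / γ) * (1 - expMeasure 1 (Set.Iio (6 / γ)) ^ n)) := by
        gcongr
        rw [ENNReal.ofReal_inv_of_pos two_pos, ENNReal.ofReal_ofNat]
        calc (2 : ENNReal)⁻¹ = 1 - 2⁻¹ := ENNReal.one_sub_inv_two.symm
          _ ≤ _ := tsub_le_tsub_left hn 1
    _ ≤ ENNReal.ofReal γ * optRevenue (expMeasure 1) 1 (monopsony n) := by
        gcongr
        exact le_optRevenue_monopsony hp
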